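/- Let $\lambda,b,\delta>0$, $r\in(0,1]$ and $c_2<c_1$. Let $N=(N_t)_{t\ge0}$ be a Poisson process with parameter $\lambda$ (the counting process of i.i.d. exponential interclaim times with rate $\lambda$) and let $X_1,X_2,\dots$ be non-negative i.i.d. random variables, independent of $N$, with probability density $f$, distribution function $F$ and tail $\bar F=1-F$. Assume that $E X_1<\infty$ and $\lambda E X_1<c_2$. Put $S(t)=\sum_{i=1}^{N_t}X_i$, and for $u\ge 0$ let $U_b$ be the refracted risk process with $U_b(0)=u$, which satisfies $dU_b(t)=c_1\,dt-dS(t)$ when $U_b(t)\le b$ and $dU_b(t)=c_2\,dt-dS(t)$ when $U_b(t)>b$. Let $\tau=\inf\{t>0:U_b(t)<0\}$ (with $\inf\emptyset=\infty$) be the ruin time, and let $$\phi(u)=E\big[r^{N_\tau}e^{-\delta\tau}\mathbb 1(\tau<\infty)\,\big|\,U_b(0)=u\big],\qquad u\ge0,$$ where $\phi_1$ denotes the restriction of $\phi$ to $[0,b]$ and $\phi_2$ its restriction to $(b,\infty)$. Then the expectation and all integrals below exist, $\phi_1$ is differentiable on $[0,b]$ (one-sidedly at the end points), $\phi_2$ is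 differentiable on $(b,\infty)$, and $$\phi_1'(u)=\frac{\lambda+\delta}{c_1}\phi_1(u)-\frac{\lambda r}{c_1}\int_0^u\phi_1(u-x)f(x)\,dx-\frac{\lambda r}{c_1}\bar F(u),\qquad 0\le u\le b,$$ $$\phi_2'(u)=\frac{\lambda+\delta}{c_2}\phi_2(u)-\frac{\lambda r}{c_2}\left(\int_0^{u-b}\phi_2(u-x)f(x)\,dx+\int_{u-b}^u\phi_1(u-x)f(x)\,dx\right)-\frac{\lambda r}{c_2}\bar F(u),\qquad u>b,$$ with the boundary condition $$\phi_1(b)=\phi_2(b):=\lim_{u\to b^+}\phi_2(u),$$ where in particular this limit exists. -/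

import Mathlib

open MeasureTheory ProbabilityTheory Set Filter Topology

noncomputable section

namespace RefractedRisk

/-- The epoch `w 0 + ⋯ + w (n - 1)` of the `n`-th claim, for interclaim times `w 0, w 1, …`. -/
def claimEpoch (w : ℕ → ℝ) (n : ℕ) : ℝ := ∑ i ∈ Finset.range n, w i

/-- The number `N_t` of claims up to and including time `t`.  When the interclaim times are
i.i.d. exponential with rate `lam`, this is the Poisson process with parameter `lam`. -/
def claimCount (w : ℕ → ℝ) (t : ℝ) : ℕ := Set.ncard {n : ℕ | claimEpoch w (n + 1) ≤ t}

/-- The aggregate claims `S(t) = X_1 + ⋯ + X_{N_t}`; the sequence `x` lists the claim sizes. -/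
def aggregateClaims (w x : ℕ → ℝ) (t : ℝ) : ℝ := ∑ i ∈ Finset.range (claimCount w t), x i

/-- Claim-free evolution: the surplus after time `t` when it starts at `z` and grows at rate `c₁`
as long as it is at most `b`, and at rate `c₂` as soon as it is above `b`. -/
def drift (c₁ c₂ b z t : ℝ) : ℝ :=
  if b < z then z + c₂ * t
  else if z + c₁ * t ≤ b then z + c₁ * t
  else b + c₂ * (t - (b - z) / c₁)

/-- The refracted surplus just after the `n`-th claim, with initial surplus `u`. -/
def surplusAtClaim (c₁ c₂ b u : ℝ) (w x : ℕ → ℝ) : ℕ → ℝ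
  | 0 => u
  | n + 1 => drift c₁ c₂ b (surplusAtClaim c₁ c₂ b u w x n) (w n) - x n

/-- The refracted surplus process `U_b(t)` with initial surplus `u`: between claims it follows
`drift`, and each claim is subtracted when it occurs.  `surplus_eq` below shows that it solves
`dU_b(t) = c₁ dt - dS(t)` when `U_b(t) ≤ b` and `dU_b(t) = c₂ dt - dS(t)` when `U_b(t) > b`. -/
def surplus (c₁ c₂ b u : ℝ) (w x : ℕ → ℝ) (t : ℝ) : ℝ :=
  drift c₁ c₂ b (surplusAtClaim c₁ c₂ b u w x (claimCount w t))
    (t - claimEpoch w (claimCount w t))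

/-- The ruin time `τ = inf {t > 0 : U_b(t) < 0}`, with `inf ∅ = ∞`. -/
def ruinTime (c₁ c₂ b u : ℝ) (w x : ℕ → ℝ) : ENNReal :=
  sInf (ENNReal.ofReal '' {t : ℝ | 0 < t ∧ surplus c₁ c₂ b u w x t < 0})

open Classical in
/-- The random variable `r ^ N_τ * e ^ (-δ τ) * 𝟙(τ < ∞)`. -/
def ruinPayoff (c₁ c₂ b r δ u : ℝ) (w x : ℕ → ℝ) : ℝ :=
  if ruinTime c₁ c₂ b u w x < ⊤ then
    r ^ claimCount w (ruinTime c₁ c₂ b u w x).toReal *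
      Real.exp (-δ * (ruinTime c₁ c₂ b u w x).toReal)
  else 0

/-- The joint Laplace transform `φ(u) = E[r ^ N_τ * e ^ (-δ τ) * 𝟙(τ < ∞) | U_b(0) = u]`, for
random interclaim times `W` and claim sizes `X`. -/
def jointLaplace {Ω : Type*} [MeasurableSpace Ω] (P : Measure Ω) (W X : ℕ → Ω → ℝ)
    (c₁ c₂ b r δ u : ℝ) : ℝ :=
  ∫ ω, ruinPayoff c₁ c₂ b r δ u (fun i => W i ω) (fun i => X i ω) ∂P

theorem drift_zero (c₁ c₂ b z : ℝ) : drift c₁ c₂ b z 0 = z := by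
  unfold drift
  split_ifs <;> simp_all

theorem drift_gt_iff (c₁ c₂ b z t : ℝ) (h1 : 0 < c₁) (h2 : 0 < c₂) (ht : 0 ≤ t) :
    b < drift c₁ c₂ b z t ↔ (b - z) / c₁ < t ∨ b < z := by
  have key : (b - z) / c₁ < t ↔ b < z + c₁ * t := by
    rw [div_lt_iff₀ h1]; constructor <;> intro h <;> linarith
  unfold drift
  split_ifs with hz hc
  · have := mul_nonneg h2.le ht
    simp only [hz, or_true, iff_true]; linarith
  · rw [key]; simp [hz]
  · have h' : (b - z) / c₁ < t := key.2 (not_le.1 hc)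
    have := mul_pos h2 (sub_pos.2 h')
    simp only [h', true_or, iff_true]; linarith

open Classical in
/-- Time spent above `b` by the claim-free evolution. -/
theorem drift_integral (c₁ c₂ b z t : ℝ) (h1 : 0 < c₁) (h2 : 0 < c₂) (ht : 0 ≤ t) :
    IntervalIntegrable (fun s => if b < drift c₁ c₂ b z s then (1 : ℝ) else 0) volume 0 t ∧
    drift c₁ c₂ b z t =
      z + c₁ * t - (c₁ - c₂) * ∫ s in (0 : ℝ)..t, if b < drift c₁ c₂ b z s then (1 : ℝ) else 0 := by
  have const : ∀ p q k : ℝ, p ≤ q → (∀ s, p < s → s < q → 0 ≤ s →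
      (if b < drift c₁ c₂ b z s then (1 : ℝ) else 0) = k) → 0 ≤ p →
      IntervalIntegrable (fun s => if b < drift c₁ c₂ b z s then (1 : ℝ) else 0) volume p q ∧
      (∫ s in p..q, if b < drift c₁ c₂ b z s then (1 : ℝ) else 0) = (q - p) * k := by
    intro p q k hpq hk hp
    have hae : (fun _ : ℝ => k) =ᵐ[volume.restrict (Set.uIoc p q)]
        (fun s => if b < drift c₁ c₂ b z s then (1 : ℝ) else 0) := by
      rw [Set.uIoc_of_le hpq, ← MeasureTheory.restrict_Ioo_eq_restrict_Ioc]
      filter_upwards [ae_restrict_mem measurableSet_Ioo] with s hs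
      exact (hk s hs.1 hs.2 (hp.trans hs.1.le)).symm
    refine ⟨(intervalIntegrable_const (c := k)).congr_ae hae, ?_⟩
    rw [← intervalIntegral.integral_congr_ae_restrict hae]
    simp
  by_cases hz : b < z
  · obtain ⟨hi, he⟩ := const 0 t 1 ht
      (fun s _ _ h => if_pos ((drift_gt_iff c₁ c₂ b z s h1 h2 h).2 (Or.inr hz))) le_rfl
    refine ⟨hi, ?_⟩
    rw [he]; simp only [drift, if_pos hz]; ring
  · by_cases hc : z + c₁ * t ≤ b
    · have ht' : t ≤ (b - z) / c₁ := by rw [le_div_iff₀ h1]; linarith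
      obtain ⟨hi, he⟩ := const 0 t 0 ht (fun s _ hs h => if_neg (by
        rw [drift_gt_iff c₁ c₂ b z s h1 h2 h]; push Not
        exact ⟨(hs.trans_le ht').le, not_lt.1 hz⟩)) le_rfl
      refine ⟨hi, ?_⟩
      rw [he]; simp only [drift, if_neg hz, if_pos hc]; ring
    · have ht' : (b - z) / c₁ ≤ t := by rw [div_le_iff₀ h1]; linarith
      have hz0 : 0 ≤ (b - z) / c₁ := div_nonneg (by linarith) h1.le
      obtain ⟨hi, he⟩ := const 0 ((b - z) / c₁) 0 hz0 (fun s _ hs h => if_neg (by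
        rw [drift_gt_iff c₁ c₂ b z s h1 h2 h]; push Not
        exact ⟨hs.le, not_lt.1 hz⟩)) le_rfl
      obtain ⟨hi', he'⟩ := const ((b - z) / c₁) t 1 ht' (fun s hs _ h => if_pos
        ((drift_gt_iff c₁ c₂ b z s h1 h2 h).2 (Or.inl hs))) hz0
      refine ⟨hi.trans hi', ?_⟩
      rw [← intervalIntegral.integral_add_adjacent_intervals hi hi', he, he']
      simp only [drift, if_neg hz, if_neg hc]
      field_simp
      ring

theorem claimEpoch_strictMono (w : ℕ → ℝ) (hw : ∀ i, 0 < w i) : StrictMono (claimEpoch w) :=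
  strictMono_nat_of_lt_succ fun n => by
    simp only [claimEpoch, Finset.sum_range_succ]; linarith [hw n]

theorem claimCount_eq (w : ℕ → ℝ) (hw : ∀ i, 0 < w i) (n : ℕ) (t : ℝ)
    (h : claimEpoch w n ≤ t) (h' : t < claimEpoch w (n + 1)) : claimCount w t = n := by
  have : {k : ℕ | claimEpoch w (k + 1) ≤ t} = (Finset.range n : Set ℕ) := by
    ext k
    simp only [mem_ofPred_eq, Finset.coe_range, mem_Iio]
    constructor
    · intro hk
      have := (claimEpoch_strictMono w hw).lt_iff_lt.1 (hk.trans_lt h')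
      omega
    · intro hk
      exact ((claimEpoch_strictMono w hw).monotone (by omega)).trans h
  rw [claimCount, this, Set.ncard_coe_finset, Finset.card_range]

open Classical in
/-- The surplus process solves the refraction equation
`U_b(t) = u + c₁ t - S(t) - (c₁ - c₂) ∫₀ᵗ 𝟙(U_b(s) > b) ds`. -/
theorem surplus_eq (c₁ c₂ b u : ℝ) (w x : ℕ → ℝ) (h1 : 0 < c₁) (h2 : 0 < c₂)
    (hw : ∀ i, 0 < w i) (hinf : Tendsto (claimEpoch w) atTop atTop) (t : ℝ) (ht : 0 ≤ t) :
    IntervalIntegrable (fun s => if b < surplus c₁ c₂ b u w x s then (1 : ℝ) else 0)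
      volume 0 t ∧
    surplus c₁ c₂ b u w x t = u + c₁ * t - aggregateClaims w x t -
      (c₁ - c₂) * ∫ s in (0 : ℝ)..t, if b < surplus c₁ c₂ b u w x s then (1 : ℝ) else 0 := by
  set g : ℝ → ℝ := fun s => if b < surplus c₁ c₂ b u w x s then (1 : ℝ) else 0 with hg
  set T := claimEpoch w with hT
  set Z := surplusAtClaim c₁ c₂ b u w x with hZ
  have hsucc : ∀ n, T (n + 1) = T n + w n := fun n => Finset.sum_range_succ _ _
  -- one claim-free period
  have piece : ∀ n, ∀ s, T n ≤ s → s ≤ T (n + 1) → IntervalIntegrable g volume (T n) s ∧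
      drift c₁ c₂ b (Z n) (s - T n) =
        Z n + c₁ * (s - T n) - (c₁ - c₂) * ∫ y in (T n)..s, g y := by
    intro n s hs hs'
    obtain ⟨hi, he⟩ := drift_integral c₁ c₂ b (Z n) (s - T n) h1 h2 (by linarith)
    have hae : (fun y => if b < drift c₁ c₂ b (Z n) (y - T n) then (1 : ℝ) else 0)
        =ᵐ[volume.restrict (Set.uIoc (T n) s)] g := by
      rw [Set.uIoc_of_le hs, ← MeasureTheory.restrict_Ioo_eq_restrict_Ioc]
      filter_upwards [ae_restrict_mem measurableSet_Ioo] with y hy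
      simp only [hg, surplus, claimCount_eq w hw n y hy.1.le (hy.2.trans_le hs')]
      rfl
    have hi2 := hi.comp_sub_right (T n)
    simp only [zero_add, sub_add_cancel] at hi2
    refine ⟨hi2.congr_ae hae, ?_⟩
    rw [he, ← intervalIntegral.integral_congr_ae_restrict hae,
      intervalIntegral.integral_comp_sub_right
        (fun y => if b < drift c₁ c₂ b (Z n) y then (1 : ℝ) else 0), sub_self]
  have main : ∀ n, IntervalIntegrable g volume 0 (T n) ∧
      Z n = u + c₁ * T n - (∑ i ∈ Finset.range n, x i) - (c₁ - c₂) * ∫ y in (0 : ℝ)..(T n), g y := by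
    intro n
    induction n with
    | zero => simp [hT, hZ, claimEpoch, surplusAtClaim]
    | succ n ih =>
      obtain ⟨hi, he⟩ := piece n (T (n + 1)) (by linarith [hsucc n, hw n]) le_rfl
      refine ⟨ih.1.trans hi, ?_⟩
      have hs : Z (n + 1) = drift c₁ c₂ b (Z n) (T (n + 1) - T n) - x n := by
        rw [hsucc n, add_sub_cancel_left]; rfl
      rw [hs, he, ih.2, ← intervalIntegral.integral_add_adjacent_intervals ih.1 hi,
        Finset.sum_range_succ]
      ring
  -- the period that contains `t`
  obtain ⟨n, hn, hn'⟩ : ∃ n, T n ≤ t ∧ t < T (n + 1) := by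
    obtain ⟨m, hm⟩ := (hinf.eventually_gt_atTop t).exists
    have hex : ∃ m, t < T m := ⟨m, hm⟩
    have hpos : Nat.find hex ≠ 0 := by
      intro h0
      have := Nat.find_spec hex
      rw [h0] at this
      simp only [hT, claimEpoch, Finset.range_zero, Finset.sum_empty] at this
      linarith
    obtain ⟨k, hk⟩ := Nat.exists_eq_succ_of_ne_zero hpos
    refine ⟨k, not_lt.1 (Nat.find_min hex (by omega)), ?_⟩
    have := Nat.find_spec hex
    rwa [hk] at this
  obtain ⟨hi, he⟩ := piece n t hn hn'.le
  refine ⟨(main n).1.trans hi, ?_⟩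
  have hs : surplus c₁ c₂ b u w x t = drift c₁ c₂ b (Z n) (t - T n) := by
    simp only [surplus, claimCount_eq w hw n t hn hn']; rfl
  rw [hs, he, (main n).2, ← intervalIntegral.integral_add_adjacent_intervals (main n).1 hi,
    aggregateClaims, claimCount_eq w hw n t hn hn']
  ring

end RefractedRisk

end

noncomputable section

namespace RefractedRisk

/-! ### Pathwise description of the payoff -/

/-! The surplus increases between claims, so ruin can only occur at a claim. Conditioning on the
first claim gives the renewal equation φ(u) = λ r ∫₀^∞ e^{-(λ+δ)t} g(drift u t) dt, where g(z) = E
H(z - X₁), and H is 1 on the negative axis and φ on [0, ∞) (`expectedPayoff_eq`,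
`toReal_expectedPayoff_eq_discounted`). All starting points lie on one orbit: drift u t = D(T(u) +
t), with D the flow from 0 and T(u) its hitting time of u (`drift_eq_drift_zero`). Hence φ = λ r Ψ ∘
T on [0, ∞), where Ψ(s) is the discounted integral of g ∘ D over the future of s. Regularity is a
bootstrap. For g merely bounded and measurable, Ψ is continuous (`continuous_discounted`), hence so
is φ, and H can jump only at 0. The claim law has no atoms, so g is continuous
(`continuous_integral_sub`), and therefore Ψ' = (λ+δ)Ψ - g ∘ D (`hasDerivAt_discounted`). Since T
has slope 1/c₁ below b and 1/c₂ above, the chain rule yields both equations;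
`integral_sub_withDensity` splits g into the convolution integral and the tail. The boundary
condition is continuity of Ψ ∘ T at b. -/

/-- The sequence without its first term. -/
def tail (w : ℕ → ℝ) (i : ℕ) : ℝ := w (i + 1)

/-- The payoff `r ^ N_τ * e ^ (-δ τ)` restricted to ruin within the first `n` claims. -/
def payoffWithin (c₁ c₂ b r δ : ℝ) : ℕ → ℝ → (ℕ → ℝ) → (ℕ → ℝ) → ENNReal
  | 0, _, _, _ => 0
  | n + 1, u, w, x => ENNReal.ofReal (r * Real.exp (-δ * w 0)) *
      if drift c₁ c₂ b u (w 0) - x 0 < 0 then 1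
      else payoffWithin c₁ c₂ b r δ n (drift c₁ c₂ b u (w 0) - x 0) (tail w) (tail x)

/-- The payoff, obtained by conditioning on the claims one after the other. -/
def payoffLimit (c₁ c₂ b r δ u : ℝ) (w x : ℕ → ℝ) : ENNReal :=
  ⨆ n, payoffWithin c₁ c₂ b r δ n u w x

/-- The truncation at level 0 vanishes and can be dropped from the supremum, and multiplication by a
constant commutes with suprema in `ENNReal`. This is the pathwise form of conditioning on the first
claim. -/
theorem payoffLimit_eq (c₁ c₂ b r δ u : ℝ) (w x : ℕ → ℝ) :
    payoffLimit c₁ c₂ b r δ u w x = ENNReal.ofReal (r * Real.exp (-δ * w 0)) *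
      if drift c₁ c₂ b u (w 0) - x 0 < 0 then 1
      else payoffLimit c₁ c₂ b r δ (drift c₁ c₂ b u (w 0) - x 0) (tail w) (tail x) := by
  rw [payoffLimit, ← sup_iSup_nat_succ]
  simp only [payoffWithin, ← ENNReal.mul_iSup, zero_le, sup_of_le_right]
  split_ifs <;> simp [payoffLimit]

/-- The defining recursion peels off the last claim; the renewal argument needs the first one peeled
off. -/
theorem surplusAtClaim_succ' (c₁ c₂ b u : ℝ) (w x : ℕ → ℝ) (n : ℕ) :
    surplusAtClaim c₁ c₂ b u w x (n + 1) =
      surplusAtClaim c₁ c₂ b (drift c₁ c₂ b u (w 0) - x 0) (tail w) (tail x) n := by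
  induction n with
  | zero => rfl
  | succ n ih => rw [surplusAtClaim, ih]; rfl

theorem claimEpoch_succ' (w : ℕ → ℝ) (n : ℕ) :
    claimEpoch w (n + 1) = w 0 + claimEpoch (tail w) n := by
  simp only [claimEpoch, Finset.sum_range_succ', tail, add_comm]

theorem payoffLimit_of_surplusAtClaim_nonneg {c₁ c₂ b r δ u : ℝ} {w x : ℕ → ℝ}
    (h : ∀ n, 0 ≤ surplusAtClaim c₁ c₂ b u w x n) : payoffLimit c₁ c₂ b r δ u w x = 0 := by
  suffices H : ∀ n u w x, (∀ n, 0 ≤ surplusAtClaim c₁ c₂ b u w x n) →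
      payoffWithin c₁ c₂ b r δ n u w x = 0 by
    simp [payoffLimit, H _ u w x h]
  intro n
  induction n with
  | zero => intro u w x _; rfl
  | succ n ih =>
    intro u w x h
    have h1 : ¬ drift c₁ c₂ b u (w 0) - x 0 < 0 := not_lt.2 (h 1)
    rw [payoffWithin, if_neg h1, ih, mul_zero]
    intro k
    rw [← surplusAtClaim_succ']
    exact h _

/-- Each claim up to ruin contributes one discount factor, and the exponents add up to the claim
epoch. -/
theorem payoffLimit_of_surplusAtClaim_neg {c₁ c₂ b r δ : ℝ} (hr : 0 ≤ r) (n : ℕ)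
    {u : ℝ} {w x : ℕ → ℝ} (h : ∀ k ≤ n, 0 ≤ surplusAtClaim c₁ c₂ b u w x k)
    (hn : surplusAtClaim c₁ c₂ b u w x (n + 1) < 0) :
    payoffLimit c₁ c₂ b r δ u w x =
      ENNReal.ofReal (r ^ (n + 1) * Real.exp (-δ * claimEpoch w (n + 1))) := by
  induction n generalizing u w x with
  | zero =>
    have h1 : drift c₁ c₂ b u (w 0) - x 0 < 0 := hn
    rw [payoffLimit_eq, if_pos h1]
    simp [claimEpoch]
  | succ n ih =>
    have h1 : ¬ drift c₁ c₂ b u (w 0) - x 0 < 0 := not_lt.2 (h 1 (by omega))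
    rw [payoffLimit_eq, if_neg h1, ih, ← ENNReal.ofReal_mul (by positivity),
      claimEpoch_succ' w (n + 1), mul_add, Real.exp_add]
    · congr 1; ring
    · intro k hk
      rw [← surplusAtClaim_succ']
      exact h _ (by omega)
    · rwa [← surplusAtClaim_succ']

theorem payoffLimit_le_one {c₁ c₂ b r δ : ℝ} (hr : r ≤ 1) (hδ : 0 ≤ δ) {u : ℝ}
    {w x : ℕ → ℝ} (hw : ∀ i, 0 ≤ w i) : payoffLimit c₁ c₂ b r δ u w x ≤ 1 := by
  refine iSup_le fun n => ?_
  induction n generalizing u w x with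
  | zero => exact zero_le
  | succ n ih =>
    rw [payoffWithin]
    refine mul_le_one' (ENNReal.ofReal_le_one.2 ?_) ?_
    · refine mul_le_one₀ hr (Real.exp_pos _).le (Real.exp_le_one_iff.2 ?_)
      have := mul_nonneg hδ (hw 0)
      linarith
    · split_ifs
      · exact le_rfl
      · exact ih fun i => hw _

theorem le_drift {c₁ c₂ : ℝ} (h1 : 0 < c₁) (h2 : 0 < c₂) (b z : ℝ) {t : ℝ} (ht : 0 ≤ t) :
    z ≤ drift c₁ c₂ b z t := by
  have i1 := mul_nonneg h1.le ht
  unfold drift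
  split_ifs with hz hc
  · have := mul_nonneg h2.le ht
    linarith
  · linarith
  · have : 0 ≤ t - (b - z) / c₁ := by
      rw [sub_nonneg, div_le_iff₀ h1]; linarith
    have := mul_nonneg h2.le this
    linarith

theorem claimEpoch_claimCount_le (w : ℕ → ℝ) (hw : ∀ i, 0 < w i) {t : ℝ} (ht : 0 ≤ t) :
    claimEpoch w (claimCount w t) ≤ t := by
  by_cases hex : ∃ m, t < claimEpoch w m
  · have hpos : Nat.find hex ≠ 0 := by
      intro h0
      have := Nat.find_spec hex
      rw [h0] at this
      simp only [claimEpoch, Finset.range_zero, Finset.sum_empty] at this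
      linarith
    obtain ⟨k, hk⟩ := Nat.exists_eq_succ_of_ne_zero hpos
    have h1 : claimEpoch w k ≤ t := not_lt.1 (Nat.find_min hex (by omega))
    have h2 := Nat.find_spec hex
    rw [hk] at h2
    rwa [claimCount_eq w hw k t h1 h2]
  · push Not at hex
    have : {n : ℕ | claimEpoch w (n + 1) ≤ t} = Set.univ := by
      ext n; simp [hex]
    -- If all epochs stay below `t`, the set of claims is infinite and its `ncard` is the default 0,
    -- so only `0 ≤ t` remains.
    rw [claimCount, this, Set.ncard_univ, Nat.card_eq_zero_of_infinite]
    simpa [claimEpoch] using ht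

theorem surplus_nonneg {c₁ c₂ b u : ℝ} {w x : ℕ → ℝ} (h1 : 0 < c₁) (h2 : 0 < c₂)
    (hw : ∀ i, 0 < w i) {t : ℝ} (ht : 0 ≤ t)
    (h : ∀ k, claimEpoch w k ≤ t → 0 ≤ surplusAtClaim c₁ c₂ b u w x k) :
    0 ≤ surplus c₁ c₂ b u w x t := by
  have hle := claimEpoch_claimCount_le w hw ht
  exact (h _ hle).trans (le_drift h1 h2 b _ (sub_nonneg.2 hle))

theorem ruinTime_eq_top {c₁ c₂ b u : ℝ} {w x : ℕ → ℝ} (h1 : 0 < c₁) (h2 : 0 < c₂)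
    (hw : ∀ i, 0 < w i) (h : ∀ n, 0 ≤ surplusAtClaim c₁ c₂ b u w x n) :
    ruinTime c₁ c₂ b u w x = ⊤ := by
  have : {t : ℝ | 0 < t ∧ surplus c₁ c₂ b u w x t < 0} = ∅ := by
    refine Set.eq_empty_of_forall_notMem fun t ht => ?_
    exact ht.2.not_ge (surplus_nonneg h1 h2 hw ht.1.le fun k _ => h k)
  rw [ruinTime, this, Set.image_empty, sInf_empty]

/-- The infimum is attained at the ruinous claim; at any earlier time only claims of index at most
`n` have occurred, and the drift never lowers the surplus. -/
theorem ruinTime_eq_claimEpoch {c₁ c₂ b u : ℝ} {w x : ℕ → ℝ} (h1 : 0 < c₁) (h2 : 0 < c₂)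
    (hw : ∀ i, 0 < w i) {n : ℕ} (h : ∀ k ≤ n, 0 ≤ surplusAtClaim c₁ c₂ b u w x k)
    (hn : surplusAtClaim c₁ c₂ b u w x (n + 1) < 0) :
    ruinTime c₁ c₂ b u w x = ENNReal.ofReal (claimEpoch w (n + 1)) := by
  have hmono := claimEpoch_strictMono w hw
  have hpos : 0 < claimEpoch w (n + 1) := by
    have := hmono (Nat.succ_pos n)
    simpa [claimEpoch] using this
  refine le_antisymm (sInf_le ⟨_, ⟨hpos, ?_⟩, rfl⟩) (le_sInf ?_)
  · rwa [surplus, claimCount_eq w hw (n + 1) _ le_rfl (hmono (Nat.lt_succ_self _)), sub_self,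
      drift_zero]
  · rintro _ ⟨t, ⟨ht, hneg⟩, rfl⟩
    refine ENNReal.ofReal_le_ofReal (not_lt.1 fun hlt => ?_)
    refine hneg.not_ge (surplus_nonneg h1 h2 hw ht.le fun k hk => h k ?_)
    have := hmono.lt_iff_lt.1 (hk.trans_lt hlt)
    omega

theorem ruinPayoff_eq_payoffLimit {c₁ c₂ b r δ u : ℝ} {w x : ℕ → ℝ} (h1 : 0 < c₁)
    (h2 : 0 < c₂) (hr : 0 ≤ r) (hw : ∀ i, 0 < w i) (hu : 0 ≤ u) :
    ruinPayoff c₁ c₂ b r δ u w x = (payoffLimit c₁ c₂ b r δ u w x).toReal := by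
  by_cases hex : ∃ n, surplusAtClaim c₁ c₂ b u w x n < 0
  · classical
    have hpos : Nat.find hex ≠ 0 := by
      intro h0
      have := Nat.find_spec hex
      rw [h0] at this
      exact this.not_ge hu
    obtain ⟨n, hk⟩ := Nat.exists_eq_succ_of_ne_zero hpos
    have hn := Nat.find_spec hex
    rw [hk] at hn
    have h : ∀ k ≤ n, 0 ≤ surplusAtClaim c₁ c₂ b u w x k := fun k hkn =>
      not_lt.1 (Nat.find_min hex (by omega))
    have hmono := claimEpoch_strictMono w hw
    have hpos : 0 < claimEpoch w (n + 1) := by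
      have := hmono (Nat.succ_pos n)
      simpa [claimEpoch] using this
    rw [ruinPayoff, ruinTime_eq_claimEpoch h1 h2 hw h hn, if_pos ENNReal.ofReal_lt_top,
      payoffLimit_of_surplusAtClaim_neg hr n h hn, ENNReal.toReal_ofReal hpos.le,
      ENNReal.toReal_ofReal (by positivity),
      claimCount_eq w hw (n + 1) _ le_rfl (hmono (Nat.lt_succ_self _))]
  · push Not at hex
    rw [ruinPayoff, ruinTime_eq_top h1 h2 hw hex, payoffLimit_of_surplusAtClaim_nonneg hex]
    simp

/-! ### Measurability -/

theorem measurable_tail : Measurable tail :=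
  measurable_pi_lambda _ fun i => measurable_pi_apply (i + 1)

theorem measurable_drift (c₁ c₂ b : ℝ) :
    Measurable fun p : ℝ × ℝ => drift c₁ c₂ b p.1 p.2 := by
  unfold drift
  refine Measurable.ite (measurableSet_lt measurable_const measurable_fst) (by fun_prop)
    (Measurable.ite (measurableSet_le (by fun_prop) measurable_const) (by fun_prop)
      (by fun_prop))

theorem measurable_payoffWithin (c₁ c₂ b r δ : ℝ) (n : ℕ) :
    Measurable fun p : ℝ × (ℕ → ℝ) × (ℕ → ℝ) =>
      payoffWithin c₁ c₂ b r δ n p.1 p.2.1 p.2.2 := by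
  induction n with
  | zero => exact measurable_const
  | succ n ih =>
    have hd : Measurable fun p : ℝ × (ℕ → ℝ) × (ℕ → ℝ) =>
        drift c₁ c₂ b p.1 (p.2.1 0) - p.2.2 0 :=
      ((measurable_drift c₁ c₂ b).comp
        (measurable_fst.prodMk ((measurable_pi_apply 0).comp measurable_snd.fst))).sub
        ((measurable_pi_apply 0).comp measurable_snd.snd)
    simp only [payoffWithin]
    refine Measurable.mul (by fun_prop) (Measurable.ite (measurableSet_lt hd measurable_const)
      measurable_const ?_)
    exact ih.comp (hd.prodMk ((measurable_tail.comp measurable_snd.fst).prodMk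
      (measurable_tail.comp measurable_snd.snd)))

theorem measurable_payoffLimit (c₁ c₂ b r δ : ℝ) :
    Measurable fun p : ℝ × (ℕ → ℝ) × (ℕ → ℝ) =>
      payoffLimit c₁ c₂ b r δ p.1 p.2.1 p.2.2 :=
  Measurable.iSup fun n => measurable_payoffWithin c₁ c₂ b r δ n

/-! ### Separating the first term of an i.i.d. sequence -/

/-- The sequence with first term `a` followed by `w`. -/
def cons (a : ℝ) (w : ℕ → ℝ) : ℕ → ℝ
  | 0 => a
  | n + 1 => w n

theorem measurable_cons : Measurable fun p : ℝ × (ℕ → ℝ) => cons p.1 p.2 := by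
  refine measurable_pi_lambda _ fun i => ?_
  cases i with
  | zero => exact measurable_fst
  | succ n => exact (measurable_pi_apply n).comp measurable_snd

/-- An infinite product measure is determined by finite-dimensional boxes, and the preimage of a box
under `cons` is a box in the first coordinate times a shifted box. -/
theorem map_cons_infinitePi (ν : Measure ℝ) [IsProbabilityMeasure ν] :
    (ν.prod (Measure.infinitePi fun _ : ℕ => ν)).map (fun p => cons p.1 p.2) =
      Measure.infinitePi fun _ : ℕ => ν := by
  refine Measure.eq_infinitePi _ fun s t ht => ?_
  rw [Measure.map_apply measurable_cons (MeasurableSet.pi s.countable_toSet fun i _ => ht i)]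
  have hpre : (fun p : ℝ × (ℕ → ℝ) => cons p.1 p.2) ⁻¹' (Set.pi s t) =
      (if 0 ∈ s then t 0 else univ) ×ˢ
        Set.pi (s.preimage Nat.succ Nat.succ_injective.injOn : Finset ℕ) (fun i => t (i + 1)) := by
    ext ⟨a, w⟩
    simp only [Set.mem_preimage, Set.mem_pi, Finset.mem_coe, Set.mem_prod, Finset.mem_preimage]
    constructor
    · intro h
      refine ⟨?_, fun i hi => h (i + 1) hi⟩
      split_ifs with h0
      · exact h 0 h0
      · trivial
    · rintro ⟨h0, h⟩ i hi
      cases i with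
      | zero => rwa [if_pos hi] at h0
      | succ n => exact h n hi
  rw [hpre, Measure.prod_prod, Measure.infinitePi_pi _ fun i _ => ht (i + 1)]
  have himg : ∏ i ∈ s.preimage Nat.succ Nat.succ_injective.injOn, ν (t (i + 1)) =
      ∏ i ∈ s.erase 0, ν (t i) := by
    classical
    refine (Finset.prod_preimage' Nat.succ s _ (fun i => ν (t i))).trans ?_
    congr 1
    ext i
    cases i <;> simp
  rw [himg]
  split_ifs with h0
  · exact Finset.mul_prod_erase s (fun i => ν (t i)) h0
  · rw [measure_univ, one_mul, Finset.erase_eq_of_notMem h0]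

theorem lintegral_infinitePi_cons (ν : Measure ℝ) [IsProbabilityMeasure ν]
    {F : (ℕ → ℝ) → ENNReal} (hF : Measurable F) :
    ∫⁻ w, F w ∂(Measure.infinitePi fun _ : ℕ => ν) =
      ∫⁻ a, ∫⁻ w, F (cons a w) ∂(Measure.infinitePi fun _ : ℕ => ν) ∂ν := by
  conv_lhs => rw [← map_cons_infinitePi ν]
  rw [lintegral_map hF measurable_cons]
  exact lintegral_prod _ (hF.comp measurable_cons).aemeasurable

/-! ### The recursive equation for the transform -/

/-- The expected payoff as an extended nonnegative real. -/
def expectedPayoff (μ ν : Measure ℝ) (c₁ c₂ b r δ u : ℝ) : ENNReal :=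
  ∫⁻ w, ∫⁻ x, payoffLimit c₁ c₂ b r δ u w x ∂(Measure.infinitePi fun _ : ℕ => ν)
    ∂(Measure.infinitePi fun _ : ℕ => μ)

/-- The expected payoff right after a claim: it is one if the claim has caused ruin. -/
def payoffAfterClaim (μ ν : Measure ℝ) (c₁ c₂ b r δ z : ℝ) : ENNReal :=
  if z < 0 then 1 else expectedPayoff μ ν c₁ c₂ b r δ z

variable (μ ν : Measure ℝ) [IsProbabilityMeasure μ] [IsProbabilityMeasure ν]
  (c₁ c₂ b r δ : ℝ)

theorem measurable_expectedPayoff : Measurable (expectedPayoff μ ν c₁ c₂ b r δ) := by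
  have h := measurable_payoffLimit c₁ c₂ b r δ
  have h' : Measurable fun p : (ℝ × (ℕ → ℝ)) × (ℕ → ℝ) =>
      payoffLimit c₁ c₂ b r δ p.1.1 p.1.2 p.2 :=
    h.comp (measurable_fst.fst.prodMk (measurable_fst.snd.prodMk measurable_snd))
  exact Measurable.lintegral_prod_right' h'.lintegral_prod_right'

theorem measurable_payoffAfterClaim : Measurable (payoffAfterClaim μ ν c₁ c₂ b r δ) :=
  Measurable.ite measurableSet_Iio measurable_const (measurable_expectedPayoff μ ν c₁ c₂ b r δ)

/-- The renewal equation: split off the first interclaim time and the first claim; the remaining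
sequences have the original laws. -/
theorem expectedPayoff_eq (u : ℝ) :
    expectedPayoff μ ν c₁ c₂ b r δ u = ∫⁻ t, ENNReal.ofReal (r * Real.exp (-δ * t)) *
      ∫⁻ y, payoffAfterClaim μ ν c₁ c₂ b r δ (drift c₁ c₂ b u t - y) ∂ν ∂μ := by
  have h := measurable_payoffLimit c₁ c₂ b r δ
  have hx (z : ℝ) (w : ℕ → ℝ) : Measurable fun x => payoffLimit c₁ c₂ b r δ z w x :=
    h.comp (measurable_const.prodMk (measurable_const.prodMk measurable_id))
  have hwx (z : ℝ) : Measurable fun p : (ℕ → ℝ) × (ℕ → ℝ) =>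
      payoffLimit c₁ c₂ b r δ z p.1 p.2 :=
    h.comp (measurable_const.prodMk measurable_id)
  rw [expectedPayoff, lintegral_infinitePi_cons μ (hwx u).lintegral_prod_right']
  refine lintegral_congr fun t => ?_
  have hd : Measurable fun p : (ℕ → ℝ) × ℝ => drift c₁ c₂ b u t - p.2 := by fun_prop
  have key : ∀ w y, ∫⁻ x, payoffLimit c₁ c₂ b r δ u (cons t w) (cons y x)
        ∂(Measure.infinitePi fun _ : ℕ => ν) =
      ENNReal.ofReal (r * Real.exp (-δ * t)) * if drift c₁ c₂ b u t - y < 0 then 1 else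
        ∫⁻ x, payoffLimit c₁ c₂ b r δ (drift c₁ c₂ b u t - y) w x
          ∂(Measure.infinitePi fun _ : ℕ => ν) := by
    intro w y
    have : ∀ x, payoffLimit c₁ c₂ b r δ u (cons t w) (cons y x) =
        ENNReal.ofReal (r * Real.exp (-δ * t)) * if drift c₁ c₂ b u t - y < 0 then 1 else
          payoffLimit c₁ c₂ b r δ (drift c₁ c₂ b u t - y) w x := fun x => payoffLimit_eq _ _ _ _ _ _ _ _
    simp only [this]
    split_ifs
    · simp
    · rw [lintegral_const_mul _ (hx _ _)]
  have hG : Measurable fun p : (ℕ → ℝ) × ℝ => if drift c₁ c₂ b u t - p.2 < 0 then 1 else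
      ∫⁻ x, payoffLimit c₁ c₂ b r δ (drift c₁ c₂ b u t - p.2) p.1 x
        ∂(Measure.infinitePi fun _ : ℕ => ν) := by
    refine Measurable.ite (measurableSet_lt hd measurable_const) measurable_const ?_
    refine Measurable.lintegral_prod_right' (f := fun q : ((ℕ → ℝ) × ℝ) × (ℕ → ℝ) =>
      payoffLimit c₁ c₂ b r δ (drift c₁ c₂ b u t - q.1.2) q.1.1 q.2) ?_
    exact h.comp ((hd.comp measurable_fst).prodMk (measurable_fst.fst.prodMk measurable_snd))
  simp only [lintegral_infinitePi_cons ν (hx u _), key]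
  -- Moving the first claim outside the remaining interclaim times lets the two inner integrals form
  -- the expected payoff from the new surplus.
  rw [lintegral_lintegral_swap ((hG.const_mul _).aemeasurable),
    ← lintegral_const_mul (f := fun y => payoffAfterClaim μ ν c₁ c₂ b r δ (drift c₁ c₂ b u t - y))
      _ ((measurable_payoffAfterClaim μ ν c₁ c₂ b r δ).comp
        (measurable_const.sub measurable_id))]
  refine lintegral_congr fun y => ?_
  have hGy := hG.comp (measurable_id.prodMk (measurable_const (a := y)))
  refine (lintegral_const_mul _ hGy).trans ?_
  simp only [payoffAfterClaim, expectedPayoff, Function.comp_apply, id]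
  split_ifs <;> simp

theorem expectedPayoff_le_one (hr : r ≤ 1) (hδ : 0 ≤ δ) (hμ : ∀ᵐ t ∂μ, 0 ≤ t) (u : ℝ) :
    expectedPayoff μ ν c₁ c₂ b r δ u ≤ 1 := by
  have hw : ∀ᵐ w ∂(Measure.infinitePi fun _ : ℕ => μ), ∀ i, 0 ≤ w i := by
    rw [ae_all_iff]
    intro i
    exact (measurePreserving_eval_infinitePi (fun _ : ℕ => μ) i).quasiMeasurePreserving.ae hμ
  calc expectedPayoff μ ν c₁ c₂ b r δ u
      ≤ ∫⁻ _, ∫⁻ _, 1 ∂(Measure.infinitePi fun _ : ℕ => ν)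
          ∂(Measure.infinitePi fun _ : ℕ => μ) :=
        lintegral_mono_ae (hw.mono fun w h => lintegral_mono fun x => payoffLimit_le_one hr hδ h)
    _ = 1 := by simp

theorem payoffAfterClaim_le_one (hr : r ≤ 1) (hδ : 0 ≤ δ) (hμ : ∀ᵐ t ∂μ, 0 ≤ t) (z : ℝ) :
    payoffAfterClaim μ ν c₁ c₂ b r δ z ≤ 1 := by
  unfold payoffAfterClaim
  split_ifs
  · exact le_rfl
  · exact expectedPayoff_le_one μ ν c₁ c₂ b r δ hr hδ hμ z

end RefractedRisk

end

noncomputable section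

namespace RefractedRisk

/-! ### Discounted integrals -/

/-- The discounted integral of `h` over the future of `s`. -/
def discounted (a : ℝ) (h : ℝ → ℝ) (s : ℝ) : ℝ :=
  ∫ t in Ioi (0 : ℝ), Real.exp (-a * t) * h (s + t)

theorem integrableOn_exp_mul {a : ℝ} (ha : 0 < a) {h : ℝ → ℝ} (hm : Measurable h)
    (hb : ∀ x, |h x| ≤ 1) (s : ℝ) :
    IntegrableOn (fun t => Real.exp (-a * t) * h t) (Ioi s) :=
  (exp_neg_integrableOn_Ioi s ha).mul_bdd hm.aestronglyMeasurable
    (ae_of_all _ fun x => by simpa using hb x)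

theorem intervalIntegrable_exp_mul {a : ℝ} (ha : 0 < a) {h : ℝ → ℝ} (hm : Measurable h)
    (hb : ∀ x, |h x| ≤ 1) (p q : ℝ) :
    IntervalIntegrable (fun t => Real.exp (-a * t) * h t) volume p q := by
  rw [intervalIntegrable_iff]
  exact (integrableOn_exp_mul ha hm hb (min p q)).mono_set fun x hx => hx.1

/-- Substituting s + t moves the dependence on `s` out of `h`, into a prefactor and an endpoint,
where the fundamental theorem of calculus applies. -/
theorem discounted_eq {a : ℝ} (ha : 0 < a) {h : ℝ → ℝ} (hm : Measurable h)
    (hb : ∀ x, |h x| ≤ 1) (s : ℝ) :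
    discounted a h s = Real.exp (a * s) * ((∫ t in Ioi (0 : ℝ), Real.exp (-a * t) * h t) -
      ∫ t in (0 : ℝ)..s, Real.exp (-a * t) * h t) := by
  have h1 := intervalIntegral.integral_Ioi_sub_Ioi' (integrableOn_exp_mul ha hm hb 0)
    (integrableOn_exp_mul ha hm hb s)
  rw [← h1, sub_sub_cancel]
  have h2 := (measurePreserving_add_left (volume : Measure ℝ) s).setIntegral_preimage_emb
    (measurableEmbedding_addLeft s) (fun t => Real.exp (-a * t) * h t) (Ioi s)
  rw [preimage_const_add_Ioi, sub_self] at h2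
  rw [← h2, ← integral_const_mul, discounted]
  congr 1
  ext t
  rw [← mul_assoc, ← Real.exp_add]
  congr 2
  ring

theorem continuous_discounted {a : ℝ} (ha : 0 < a) {h : ℝ → ℝ} (hm : Measurable h)
    (hb : ∀ x, |h x| ≤ 1) : Continuous (discounted a h) := by
  rw [funext (discounted_eq ha hm hb)]
  exact (by fun_prop : Continuous fun s => Real.exp (a * s)).mul (continuous_const.sub
    (intervalIntegral.continuous_primitive (intervalIntegrable_exp_mul ha hm hb) 0))

theorem hasDerivAt_discounted {a : ℝ} (ha : 0 < a) {h : ℝ → ℝ} (hc : Continuous h)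
    (hb : ∀ x, |h x| ≤ 1) (s : ℝ) :
    HasDerivAt (discounted a h) (a * discounted a h s - h s) s := by
  have hm := hc.measurable
  have hcont : Continuous fun t => Real.exp (-a * t) * h t := by fun_prop
  have h1 := intervalIntegral.integral_hasDerivAt_right
    (intervalIntegrable_exp_mul ha hm hb 0 s)
    (hcont.stronglyMeasurableAtFilter volume (𝓝 s)) hcont.continuousAt
  have h2 : HasDerivAt (fun s => Real.exp (a * s)) (Real.exp (a * s) * (a * 1)) s :=
    ((hasDerivAt_id s).const_mul a).exp
  have h3 := h2.mul ((hasDerivAt_const s (∫ t in Ioi (0 : ℝ), Real.exp (-a * t) * h t)).sub h1)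
  have h4 : Real.exp (a * s) * Real.exp (-a * s) = 1 := by
    rw [← Real.exp_add]; simp
  rw [funext (discounted_eq ha hm hb)]
  refine h3.congr_deriv ?_
  simp only [Pi.sub_apply]
  linear_combination (-h s) * h4

theorem integral_expMeasure {lam : ℝ} (hlam : 0 < lam) (F : ℝ → ℝ) :
    ∫ t, F t ∂(expMeasure lam) = ∫ t in Ioi (0 : ℝ), lam * Real.exp (-(lam * t)) * F t := by
  have h1 : expMeasure lam = volume.withDensity (exponentialPDF lam) := rfl
  have hm : Measurable (exponentialPDF lam) :=
    (measurable_exponentialPDFReal lam).ennreal_ofReal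
  rw [h1, integral_withDensity_eq_integral_toReal_smul hm
    (ae_of_all _ fun _ => ENNReal.ofReal_lt_top), ← integral_Ici_eq_integral_Ioi,
    ← integral_indicator measurableSet_Ici]
  congr 1
  ext t
  rw [exponentialPDF_eq, indicator_apply]
  by_cases ht : 0 ≤ t
  · rw [if_pos ht, if_pos (mem_Ici.2 ht), ENNReal.toReal_ofReal (by positivity), smul_eq_mul]
  · rw [if_neg ht, if_neg (by simpa using ht)]
    simp

/-! ### The deterministic flow -/

/-- The time at which the claim-free evolution started at zero reaches `u`. -/
def hittingTime (c₁ c₂ b u : ℝ) : ℝ :=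
  if u ≤ b then u / c₁ else b / c₁ + (u - b) / c₂

/-- The flow is autonomous, so the starting point enters only as a time shift; differentiating in
`u` becomes differentiating in time. -/
theorem drift_eq_drift_zero {c₁ c₂ b : ℝ} (h1 : 0 < c₁) (h2 : 0 < c₂) (hb : 0 ≤ b) (u : ℝ)
    {t : ℝ} (ht : 0 ≤ t) :
    drift c₁ c₂ b u t = drift c₁ c₂ b 0 (hittingTime c₁ c₂ b u + t) := by
  unfold drift hittingTime
  rw [if_neg (not_lt.2 hb)]
  by_cases hu : u ≤ b
  · have e : 0 + c₁ * (u / c₁ + t) = u + c₁ * t := by field_simp; ring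
    rw [if_neg (not_lt.2 hu), if_pos hu, e]
    split_ifs
    · rfl
    · ring
  · have hu' := not_le.1 hu
    have e : ¬ 0 + c₁ * (b / c₁ + (u - b) / c₂ + t) ≤ b := by
      have : 0 + c₁ * (b / c₁ + (u - b) / c₂ + t) = b + c₁ * ((u - b) / c₂ + t) := by
        field_simp; ring
      rw [this]
      have h3 : 0 < (u - b) / c₂ := div_pos (sub_pos.2 hu') h2
      have := mul_pos h1 (add_pos_of_pos_of_nonneg h3 ht)
      linarith
    rw [if_pos hu', if_neg hu, if_neg e]
    field_simp
    ring

theorem drift_hittingTime {c₁ c₂ b : ℝ} (h1 : 0 < c₁) (h2 : 0 < c₂) (hb : 0 ≤ b) (u : ℝ) :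
    drift c₁ c₂ b 0 (hittingTime c₁ c₂ b u) = u := by
  have := drift_eq_drift_zero h1 h2 hb u le_rfl
  rw [drift_zero, add_zero] at this
  exact this.symm

theorem continuous_drift_zero {c₁ c₂ b : ℝ} (h1 : 0 < c₁) (hb : 0 ≤ b) :
    Continuous (drift c₁ c₂ b 0) := by
  have : drift c₁ c₂ b 0 = fun s =>
      if c₁ * s ≤ b then c₁ * s else b + c₂ * (s - b / c₁) := by
    ext s; simp [drift, not_lt.2 hb]
  rw [this]
  refine Continuous.if_le (by fun_prop) (by fun_prop) (by fun_prop) continuous_const ?_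
  intro s hs
  rw [← hs]
  field_simp
  ring

theorem continuous_hittingTime (c₁ c₂ b : ℝ) : Continuous (hittingTime c₁ c₂ b) := by
  unfold hittingTime
  refine Continuous.if_le (by fun_prop) (by fun_prop) continuous_id continuous_const ?_
  rintro s rfl
  simp

/-! ### The mean payoff at the first claim -/

/-- Dominated convergence: the possible jump of `H` at 0 is met only for y = z, a null event. -/
theorem continuous_integral_sub (ν : Measure ℝ) [IsProbabilityMeasure ν] [NullSingletonClass ν]
    {H : ℝ → ℝ} (hm : Measurable H) (hb : ∀ x, |H x| ≤ 1)
    (hc : ∀ x, x ≠ 0 → ContinuousAt H x) : Continuous fun z => ∫ y, H (z - y) ∂ν := by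
  rw [continuous_iff_continuousAt]
  intro z
  refine continuousAt_of_dominated (bound := fun _ => 1) (Eventually.of_forall fun x =>
    (hm.comp (measurable_const.sub measurable_id)).aestronglyMeasurable)
    (Eventually.of_forall fun x => ae_of_all _ fun y => by simpa using hb (x - y))
    (integrable_const _) ?_
  have : ∀ᵐ y ∂ν, y ≠ z := by
    rw [ae_iff]; simp
  filter_upwards [this] with y hy
  have h1 : ContinuousAt H (z - y) := hc _ (sub_ne_zero.2 hy.symm)
  exact ContinuousAt.comp (f := fun x => x - y) h1 (by fun_prop)

/-- Split at y = u: a larger claim causes ruin, where `H` is 1, and contributes the tail; smaller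
claims contribute the convolution. -/
theorem integral_sub_withDensity {f : ℝ → ℝ} (hfm : Measurable f) (hf : ∀ x, 0 ≤ f x)
    (ν : Measure ℝ) [IsProbabilityMeasure ν] [NullSingletonClass ν]
    (hν : ν = volume.withDensity fun x => ENNReal.ofReal (f x)) (hν0 : ∀ᵐ y ∂ν, 0 ≤ y)
    {H φ : ℝ → ℝ} (hm : Measurable H) (hb : ∀ x, |H x| ≤ 1) (hneg : ∀ x < 0, H x = 1)
    (hφ : ∀ x, 0 ≤ x → φ x = H x) {u : ℝ} (hu : 0 ≤ u) :
    IntervalIntegrable (fun x => φ (u - x) * f x) volume 0 u ∧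
    ∫ y, H (u - y) ∂ν = (∫ x in (0 : ℝ)..u, φ (u - x) * f x) + (1 - cdf ν u) := by
  have hmu : Measurable fun y => H (u - y) := hm.comp (measurable_const.sub measurable_id)
  have hfint : Integrable f := by
    refine ⟨hfm.aestronglyMeasurable, ?_⟩
    rw [hasFiniteIntegral_iff_ofReal (ae_of_all _ hf)]
    have : ν univ = ∫⁻ x, ENNReal.ofReal (f x) := by
      rw [hν, withDensity_apply _ MeasurableSet.univ, Measure.restrict_univ]
    rw [← this]
    exact measure_lt_top _ _
  have hHf : Integrable fun x => H (u - x) * f x :=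
    hfint.bdd_mul hmu.aestronglyMeasurable (ae_of_all _ fun x => by simpa using hb (u - x))
  have heq : EqOn (fun x => H (u - x) * f x) (fun x => φ (u - x) * f x) (Ioc 0 u) := by
    intro x hx
    simp only
    rw [hφ _ (sub_nonneg.2 hx.2)]
  have hHint : Integrable (fun y => H (u - y)) ν :=
    Integrable.of_bound hmu.aestronglyMeasurable 1 (ae_of_all _ fun x => by simpa using hb (u - x))
  constructor
  · rw [intervalIntegrable_iff, uIoc_of_le hu]
    exact hHf.integrableOn.congr_fun heq measurableSet_Ioc
  · rw [← integral_add_compl (measurableSet_Iic (a := u)) hHint, compl_Iic]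
    congr 1
    · have hae : (Iic u : Set ℝ) =ᵐ[ν] Ioc 0 u := by
        have h0 : ∀ᵐ y ∂ν, y ≠ 0 := by rw [ae_iff]; simp
        filter_upwards [hν0, h0] with y hy hy0
        have : 0 < y := lt_of_le_of_ne hy hy0.symm
        exact propext ⟨fun h => ⟨this, h⟩, fun h => h.2⟩
      rw [setIntegral_congr_set hae, intervalIntegral.integral_of_le hu,
        ← setIntegral_congr_fun measurableSet_Ioc heq, hν,
        setIntegral_withDensity_eq_setIntegral_toReal_smul hfm.ennreal_ofReal
          (ae_of_all _ fun _ => ENNReal.ofReal_lt_top) _ measurableSet_Ioc]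
      congr 1
      ext y
      rw [ENNReal.toReal_ofReal (hf y), smul_eq_mul, mul_comm]
    · rw [setIntegral_congr_fun (g := fun _ => (1 : ℝ)) measurableSet_Ioi fun y hy =>
        hneg _ (sub_neg.2 hy), setIntegral_const, smul_eq_mul, mul_one, cdf_eq_real,
        ← compl_Iic, probReal_compl_eq_one_sub measurableSet_Iic]

/-! ### The transform of the claim sequence -/

variable (ν : Measure ℝ) [IsProbabilityMeasure ν] (c₁ c₂ b r δ lam : ℝ)

theorem ae_pos_expMeasure : ∀ᵐ t ∂(expMeasure lam), 0 < t := by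
  have h1 : expMeasure lam = volume.withDensity (exponentialPDF lam) := rfl
  have hm : Measurable (exponentialPDF lam) :=
    (measurable_exponentialPDFReal lam).ennreal_ofReal
  rw [h1, ae_withDensity_iff hm]
  have h0 : ∀ᵐ t : ℝ, t ≠ 0 := by rw [ae_iff]; simp
  filter_upwards [h0] with t ht h
  by_contra hneg
  exact h (exponentialPDF_of_neg (lt_of_le_of_ne (not_lt.1 hneg) ht))

/-- The exponential density merges with the discount into the rate λ + δ, and the flow from `u` is
read as the flow from 0 at a shifted time. -/
theorem toReal_expectedPayoff_eq_discounted (h1 : 0 < c₁) (h2 : 0 < c₂) (hb : 0 ≤ b)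
    (hr0 : 0 ≤ r) (hr : r ≤ 1) (hδ : 0 ≤ δ) (hlam : 0 < lam) (u : ℝ) :
    (expectedPayoff (expMeasure lam) ν c₁ c₂ b r δ u).toReal =
      lam * r * discounted (lam + δ) (fun s =>
        ∫ y, (payoffAfterClaim (expMeasure lam) ν c₁ c₂ b r δ (drift c₁ c₂ b 0 s - y)).toReal ∂ν)
        (hittingTime c₁ c₂ b u) := by
  have := isProbabilityMeasure_expMeasure hlam
  have hpos : ∀ᵐ t ∂(expMeasure lam), 0 ≤ t := (ae_pos_expMeasure lam).mono fun _ h => h.le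
  have hm := measurable_payoffAfterClaim (expMeasure lam) ν c₁ c₂ b r δ
  have hle := payoffAfterClaim_le_one (expMeasure lam) ν c₁ c₂ b r δ hr hδ hpos
  set A := payoffAfterClaim (expMeasure lam) ν c₁ c₂ b r δ with hA
  have hint (z : ℝ) : ∫⁻ y, A (z - y) ∂ν ≤ 1 :=
    (lintegral_mono fun y => hle (z - y)).trans (by simp)
  have hgm : Measurable fun z => ∫⁻ y, A (z - y) ∂ν :=
    Measurable.lintegral_prod_right' (f := fun p : ℝ × ℝ => A (p.1 - p.2)) (hm.comp (by fun_prop))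
  have hreal (z : ℝ) : ∫ y, (A (z - y)).toReal ∂ν = (∫⁻ y, A (z - y) ∂ν).toReal :=
    integral_toReal (hm.comp (measurable_const.sub measurable_id)).aemeasurable
      (ae_of_all _ fun y => (hle _).trans_lt ENNReal.one_lt_top)
  have hd : Measurable fun t => drift c₁ c₂ b u t :=
    (measurable_drift c₁ c₂ b).comp (measurable_const.prodMk measurable_id)
  rw [expectedPayoff_eq, ← integral_toReal, integral_expMeasure hlam, discounted,
    ← integral_const_mul]
  · refine setIntegral_congr_fun measurableSet_Ioi fun t ht => ?_
    rw [ENNReal.toReal_mul, ENNReal.toReal_ofReal (by positivity), ← hA, ← hreal,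
      ← drift_eq_drift_zero h1 h2 hb u (le_of_lt ht)]
    have : Real.exp (-(lam + δ) * t) = Real.exp (-(lam * t)) * Real.exp (-δ * t) := by
      rw [← Real.exp_add]; congr 1; ring
    rw [this]
    ring
  · exact (Measurable.mul (by fun_prop) (hgm.comp hd)).aemeasurable
  · exact ae_of_all _ fun t => ENNReal.mul_lt_top ENNReal.ofReal_lt_top
      ((hint _).trans_lt ENNReal.one_lt_top)

end RefractedRisk

end

noncomputable section

namespace RefractedRisk

/-! ### The transform of random claim sequences -/

theorem lintegral_iid_pair {Ω : Type*} [MeasurableSpace Ω] {P : Measure Ω}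
    [IsProbabilityMeasure P] {μ ν : Measure ℝ} [IsProbabilityMeasure μ] [IsProbabilityMeasure ν]
    {W X : ℕ → Ω → ℝ} (hWm : ∀ i, Measurable (W i)) (hWind : iIndepFun W P)
    (hWlaw : ∀ i, P.map (W i) = μ) (hXm : ∀ i, Measurable (X i)) (hXind : iIndepFun X P)
    (hXlaw : ∀ i, P.map (X i) = ν)
    (hWX : IndepFun (fun ω i => W i ω) (fun ω i => X i ω) P)
    {F : (ℕ → ℝ) × (ℕ → ℝ) → ENNReal} (hF : Measurable F) :
    ∫⁻ ω, F (fun i => W i ω, fun i => X i ω) ∂P =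
      ∫⁻ w, ∫⁻ x, F (w, x) ∂(Measure.infinitePi fun _ : ℕ => ν)
        ∂(Measure.infinitePi fun _ : ℕ => μ) := by
  have hW : Measurable fun ω i => W i ω := measurable_pi_lambda _ hWm
  have hX : Measurable fun ω i => X i ω := measurable_pi_lambda _ hXm
  have hWmap := hWind.map_fun_eq_infinitePi_map hWm
  have hXmap := hXind.map_fun_eq_infinitePi_map hXm
  simp only [hWlaw] at hWmap
  simp only [hXlaw] at hXmap
  have h := (indepFun_iff_map_prod_eq_prod_map_map hW.aemeasurable hX.aemeasurable).1 hWX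
  rw [hWmap, hXmap] at h
  rw [← lintegral_prod _ hF.aemeasurable, ← h, lintegral_map hF (hW.prodMk hX)]

/-- Almost surely all interclaim times are positive, so the payoff agrees with the measurable
`payoffLimit`; measurability of the ruin time itself need not be examined. -/
theorem integrable_ruinPayoff_and_jointLaplace_eq {Ω : Type*} [MeasurableSpace Ω] {P : Measure Ω}
    [IsProbabilityMeasure P] {μ ν : Measure ℝ} [IsProbabilityMeasure μ] [IsProbabilityMeasure ν]
    {W X : ℕ → Ω → ℝ} (hWm : ∀ i, Measurable (W i)) (hWind : iIndepFun W P)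
    (hWlaw : ∀ i, P.map (W i) = μ) (hXm : ∀ i, Measurable (X i)) (hXind : iIndepFun X P)
    (hXlaw : ∀ i, P.map (X i) = ν)
    (hWX : IndepFun (fun ω i => W i ω) (fun ω i => X i ω) P)
    (hμ : ∀ᵐ t ∂μ, 0 < t) {c₁ c₂ b r δ : ℝ} (h1 : 0 < c₁) (h2 : 0 < c₂) (hr0 : 0 ≤ r)
    (hr : r ≤ 1) (hδ : 0 ≤ δ) {u : ℝ} (hu : 0 ≤ u) :
    Integrable (fun ω => ruinPayoff c₁ c₂ b r δ u (fun i => W i ω) (fun i => X i ω)) P ∧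
    jointLaplace P W X c₁ c₂ b r δ u = (expectedPayoff μ ν c₁ c₂ b r δ u).toReal := by
  have hF : Measurable fun p : (ℕ → ℝ) × (ℕ → ℝ) => payoffLimit c₁ c₂ b r δ u p.1 p.2 :=
    (measurable_payoffLimit c₁ c₂ b r δ).comp (measurable_const.prodMk measurable_id)
  have hG : Measurable fun ω =>
      payoffLimit c₁ c₂ b r δ u (fun i => W i ω) (fun i => X i ω) :=
    hF.comp ((measurable_pi_lambda _ hWm).prodMk (measurable_pi_lambda _ hXm))
  have hpos : ∀ᵐ ω ∂P, ∀ i, 0 < W i ω := by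
    rw [ae_all_iff]
    intro i
    rw [← hWlaw i] at hμ
    exact ae_of_ae_map (hWm i).aemeasurable hμ
  have hle : ∀ᵐ ω ∂P, payoffLimit c₁ c₂ b r δ u (fun i => W i ω) (fun i => X i ω) ≤ 1 :=
    hpos.mono fun ω h => payoffLimit_le_one hr hδ fun i => (h i).le
  have hae : (fun ω => (payoffLimit c₁ c₂ b r δ u (fun i => W i ω) (fun i => X i ω)).toReal)
      =ᵐ[P] fun ω => ruinPayoff c₁ c₂ b r δ u (fun i => W i ω) (fun i => X i ω) :=
    hpos.mono fun ω h => (ruinPayoff_eq_payoffLimit h1 h2 hr0 h hu).symm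
  constructor
  · refine Integrable.congr (Integrable.of_bound hG.ennreal_toReal.aestronglyMeasurable 1 ?_) hae
    filter_upwards [hle] with ω h
    rw [Real.norm_of_nonneg ENNReal.toReal_nonneg]
    exact ENNReal.toReal_mono ENNReal.one_ne_top h
  · rw [jointLaplace, ← integral_congr_ae hae, integral_toReal hG.aemeasurable
      (hle.mono fun ω h => h.trans_lt ENNReal.one_lt_top)]
    congr 1
    exact lintegral_iid_pair hWm hWind hWlaw hXm hXind hXlaw hWX hF

end RefractedRisk

end

/-! ### The integro-differential equations and the boundary condition -/

open RefractedRisk in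
theorem mainTheorem3 {Ω : Type*} [MeasurableSpace Ω] (P : Measure Ω) [IsProbabilityMeasure P]
    -- parameters of the model and of the transform
    (lam c₁ c₂ b r δ : ℝ) (hlam : 0 < lam) (hb : 0 < b) (hc : c₂ < c₁)
    (hδ : 0 < δ) (hr : r ∈ Set.Ioc (0 : ℝ) 1)
    -- interclaim times `W` of a Poisson process with parameter `lam`
    (W : ℕ → Ω → ℝ) (hWm : ∀ i, Measurable (W i)) (hWind : iIndepFun W P)
    (hWlaw : ∀ i, P.map (W i) = expMeasure lam)
    -- non-negative i.i.d. claim sizes `X` with density `f`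
    (f : ℝ → ℝ) (hfm : Measurable f) (hf : ∀ x, 0 ≤ f x)
    (X : ℕ → Ω → ℝ) (hXm : ∀ i, Measurable (X i)) (hXind : iIndepFun X P)
    (hX0 : ∀ i, ∀ᵐ ω ∂P, 0 ≤ X i ω)
    (hXlaw : ∀ i, P.map (X i) = volume.withDensity (fun x => ENNReal.ofReal (f x)))
    -- the claim sizes are independent of the claim arrivals
    (hWX : IndepFun (fun ω i => W i ω) (fun ω i => X i ω) P)
    -- net profit condition
    (hXint : Integrable (X 0) P) (hprofit : lam * ∫ ω, X 0 ω ∂P < c₂)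
    -- the transform and the tail of the claim size distribution
    (φ Fbar : ℝ → ℝ)
    (hφ : φ = fun u => RefractedRisk.jointLaplace P W X c₁ c₂ b r δ u)
    (hFbar : Fbar = fun x => 1 - cdf (P.map (X 0)) x) :
    -- the expectation defining `φ u` exists
    (∀ u, 0 ≤ u → Integrable (fun ω =>
      RefractedRisk.ruinPayoff c₁ c₂ b r δ u (fun i => W i ω) (fun i => X i ω)) P) ∧
    -- the equation on `[0, b]`, with one-sided derivatives at the end points
    (∀ u ∈ Set.Icc 0 b,
      IntervalIntegrable (fun x => φ (u - x) * f x) volume 0 u ∧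
      HasDerivWithinAt φ
        ((lam + δ) / c₁ * φ u - lam * r / c₁ * (∫ x in (0 : ℝ)..u, φ (u - x) * f x)
          - lam * r / c₁ * Fbar u) (Set.Icc 0 b) u) ∧
    -- the equation on `(b, ∞)`
    (∀ u, b < u →
      IntervalIntegrable (fun x => φ (u - x) * f x) volume 0 (u - b) ∧
      IntervalIntegrable (fun x => φ (u - x) * f x) volume (u - b) u ∧
      HasDerivAt φ
        ((lam + δ) / c₂ * φ u
          - lam * r / c₂ * ((∫ x in (0 : ℝ)..(u - b), φ (u - x) * f x)
            + ∫ x in (u - b)..u, φ (u - x) * f x)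
          - lam * r / c₂ * Fbar u) u) ∧
    -- the boundary condition
    Tendsto φ (𝓝[>] b) (𝓝 (φ b)) := by
  have hμp := isProbabilityMeasure_expMeasure hlam
  have hνp : IsProbabilityMeasure (P.map (X 0)) :=
    Measure.isProbabilityMeasure_map (hXm 0).aemeasurable
  have hνatoms : NullSingletonClass (P.map (X 0)) := by
    rw [hXlaw 0]; infer_instance
  have hν0 : ∀ᵐ y ∂(P.map (X 0)), 0 ≤ y :=
    (ae_map_iff (hXm 0).aemeasurable measurableSet_Ici).2 (hX0 0)
  -- The net profit condition with a nonnegative mean claim makes both drift rates positive.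
  have hc2 : 0 < c₂ :=
    (mul_nonneg hlam.le (integral_nonneg_of_ae (hX0 0))).trans_lt hprofit
  have hc1 : 0 < c₁ := hc2.trans hc
  have hμ0 := ae_pos_expMeasure lam
  have hμ0' : ∀ᵐ t ∂(expMeasure lam), 0 ≤ t := hμ0.mono fun _ h => h.le
  set ν := P.map (X 0) with hν
  have hXν : ∀ i, P.map (X i) = ν := fun i => by rw [hXlaw i, hν, hXlaw 0]
  have hbase : ∀ u : ℝ, 0 ≤ u → _ := fun u hu => integrable_ruinPayoff_and_jointLaplace_eq (b := b)
    hWm hWind hWlaw hXm hXind hXν hWX hμ0 hc1 hc2 hr.1.le hr.2 hδ.le hu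
  set H : ℝ → ℝ := fun z => (payoffAfterClaim (expMeasure lam) ν c₁ c₂ b r δ z).toReal with hH
  have hHm : Measurable H := (measurable_payoffAfterClaim _ ν c₁ c₂ b r δ).ennreal_toReal
  have hHb : ∀ x, |H x| ≤ 1 := fun x => by
    rw [abs_of_nonneg ENNReal.toReal_nonneg]
    exact ENNReal.toReal_mono ENNReal.one_ne_top
      (payoffAfterClaim_le_one _ ν c₁ c₂ b r δ hr.2 hδ.le hμ0' x)
  have hHneg : ∀ x < 0, H x = 1 := fun x hx => by simp [hH, payoffAfterClaim, hx]
  have hφH : ∀ x, 0 ≤ x → φ x = H x := fun x hx => by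
    simp only [hφ, hH, payoffAfterClaim, if_neg (not_lt.2 hx)]
    exact (hbase x hx).2
  set g : ℝ → ℝ := fun z => ∫ y, H (z - y) ∂ν with hg
  set D := drift c₁ c₂ b 0 with hD
  set T := hittingTime c₁ c₂ b with hT
  set a := lam + δ with ha
  have ha0 : 0 < a := add_pos hlam hδ
  have hDT : ∀ u, D (T u) = u := drift_hittingTime hc1 hc2 hb.le
  have hDc : Continuous D := continuous_drift_zero hc1 hb.le
  have hTc : Continuous T := continuous_hittingTime c₁ c₂ b
  have hgm : Measurable g := by
    have : StronglyMeasurable fun p : ℝ × ℝ => H (p.1 - p.2) :=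
      (hHm.comp (by fun_prop)).stronglyMeasurable
    exact this.integral_prod_right'.measurable
  have hgb : ∀ z, |g z| ≤ 1 := fun z => by
    have := norm_integral_le_of_norm_le_const (μ := ν) (f := fun y => H (z - y)) (C := 1)
      (ae_of_all _ fun y => hHb (z - y))
    simpa using this
  have hφψ : ∀ u, 0 ≤ u → φ u = lam * r * discounted a (fun s => g (D s)) (T u) := fun u hu => by
    rw [hφ]
    exact (hbase u hu).2.trans (toReal_expectedPayoff_eq_discounted ν c₁ c₂ b r δ lam hc1 hc2
      hb.le hr.1.le hr.2 hδ.le hlam u)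
  have hψc : Continuous fun u => lam * r * discounted a (fun s => g (D s)) (T u) :=
    continuous_const.mul ((continuous_discounted ha0 (hgm.comp hDc.measurable)
      fun s => hgb (D s)).comp hTc)
  -- The bootstrap: the renewal equation gives continuity of φ from measurability of `g` alone, and
  -- this feeds back into continuity of `g`.
  have hHc : ∀ x, x ≠ 0 → ContinuousAt H x := by
    intro x hx
    rcases lt_or_gt_of_ne hx with hx | hx
    · refine (continuousAt_const (y := (1 : ℝ))).congr ?_
      filter_upwards [Iio_mem_nhds hx] with y hy using (hHneg y hy).symm
    · refine hψc.continuousAt.congr ?_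
      filter_upwards [Ioi_mem_nhds hx] with y hy
      rw [← hφψ y (le_of_lt hy), hφH y (le_of_lt hy)]
  have hgc : Continuous g := continuous_integral_sub ν hHm hHb hHc
  have hψd : ∀ s, HasDerivAt (discounted a fun s => g (D s))
      (a * discounted a (fun s => g (D s)) s - g (D s)) s :=
    hasDerivAt_discounted ha0 (hgc.comp hDc) fun s => hgb (D s)
  have hgval : ∀ u : ℝ, 0 ≤ u → _ := fun u hu =>
    integral_sub_withDensity hfm hf ν (hXlaw 0) hν0 hHm hHb hHneg hφH hu
  refine ⟨fun u hu => (hbase u hu).1, fun u hu => ⟨(hgval u hu.1).1, ?_⟩, fun u hu => ?_, ?_⟩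
  · have hTu : T u = u / c₁ := if_pos hu.2
    have h0 : HasDerivAt (discounted a fun s => g (D s))
        (a * discounted a (fun s => g (D s)) (T u) - g (D (T u))) (u / c₁) := by
      rw [← hTu]
      exact hψd (T u)
    have h1 : HasDerivAt (fun v : ℝ => v / c₁) (1 / c₁) u := (hasDerivAt_id u).div_const c₁
    -- This function is differentiable on the whole line but is identified with φ only on [0, b],
    -- hence the one-sided derivatives at the end points.
    have h2 : HasDerivAt (fun v : ℝ => lam * r * discounted a (fun s => g (D s)) (v / c₁)) _ u :=
      (h0.comp u h1).const_mul (lam * r)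
    refine (h2.hasDerivWithinAt.congr_of_mem (fun v hv => ?_) hu).congr_deriv ?_
    · rw [hφψ v hv.1, hT, hittingTime, if_pos hv.2]
    · rw [hφψ u hu.1, hFbar, hDT]
      have : g u = _ := (hgval u hu.1).2
      simp only [this]
      ring
  · have hu0 : 0 < u := hb.trans hu
    have hi := (hgval u hu0.le).1
    have hi1 : IntervalIntegrable (fun x => φ (u - x) * f x) volume 0 (u - b) :=
      hi.mono_set (by
        rw [uIcc_of_le (sub_nonneg.2 hu.le), uIcc_of_le hu0.le]
        exact Icc_subset_Icc le_rfl (by linarith))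
    have hi2 : IntervalIntegrable (fun x => φ (u - x) * f x) volume (u - b) u :=
      hi.mono_set (by
        rw [uIcc_of_le (by linarith), uIcc_of_le hu0.le]
        exact Icc_subset_Icc (sub_nonneg.2 hu.le) le_rfl)
    refine ⟨hi1, hi2, ?_⟩
    have hTu : T u = b / c₁ + (u - b) / c₂ := if_neg (not_le.2 hu)
    have h0 : HasDerivAt (discounted a fun s => g (D s))
        (a * discounted a (fun s => g (D s)) (T u) - g (D (T u))) (b / c₁ + (u - b) / c₂) := by
      rw [← hTu]
      exact hψd (T u)
    have h1 : HasDerivAt (fun v : ℝ => b / c₁ + (v - b) / c₂) (1 / c₂) u :=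
      (((hasDerivAt_id u).sub_const b).div_const c₂).const_add _
    have h2 : HasDerivAt (fun v : ℝ =>
        lam * r * discounted a (fun s => g (D s)) (b / c₁ + (v - b) / c₂)) _ u :=
      (h0.comp u h1).const_mul (lam * r)
    refine (h2.congr_of_eventuallyEq ?_).congr_deriv ?_
    · filter_upwards [Ioi_mem_nhds hu] with v hv
      rw [hφψ v (hb.trans hv).le, hT, hittingTime, if_neg (not_le.2 hv)]
    · rw [intervalIntegral.integral_add_adjacent_intervals hi1 hi2, hφψ u hu0.le, hFbar, hDT]
      have : g u = _ := (hgval u hu0.le).2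
      simp only [this]
      ring
  -- Only the slope of `T` jumps at b; `T` itself is continuous there.
  · rw [hφψ b hb.le]
    refine (hψc.continuousAt.tendsto.mono_left nhdsWithin_le_nhds).congr' ?_
    filter_upwards [self_mem_nhdsWithin] with v hv
    exact (hφψ v (hb.trans hv).le).symm
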